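/- For a positive integer $k$ let $V^{(k)}=[k]\times[k]$, $R_i=\{(i,j):j\in[k]\}$ and $C_i=\{(j,i):j\in[k]\}$ for $i\in[k]$, and $A^T=\{(j,i):(i,j)\in A\}$ for $A\subseteq V^{(k)}$. A set function $f:2^{V^{(k)}}\to\mathbb{R}$ is of row-column type if there is $g:2^{V^{(k)}}\to\mathbb{R}_{\ge0}$ with $f(A)=\sum_{i=1}^k\bigl(g(A\cap R_i)+g(A\cap C_i)\bigr)$ for all $A\subseteq V^{(k)}$. A multiway partition is a partition $V_1,\dots,V_k$ of $V^{(k)}$ with $(i,i)\in V_i$ for all $i\in[k]$; it is symmetric if $V_i=V_i^T$ for all $i$. Let $\mathrm{OPT}(f)$ (respectively $\mathrm{OPT}_{\mathrm{Sym}}(f)$) be the minimum of $\sum_{i=1}^k f(V_i)$ over all multiway partitions (respectively all symmetric multiway partitions), and let $\mathrm{SymGap}(f)=\mathrm{OPT}_{\mathrm{Sym}}(f)/\mathrm{OPT}(f)$. **Theorem.** There is a sequence of row-column-type non-negative monotone submodular functions $f^{(k)}:2^{V^{(k)}}\to\mathbb{R}_{\ge0}$, $k\in\mathbb{N}$, such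 that $$\lim_{k\to\infty}\mathrm{SymGap}\bigl(f^{(k)}\bigr)=\frac{10}{9}.$$ Moreover, the sequence can be chosen so that for every $k\ge4$ $$f^{(k)}(S)=\sum_{i=1}^k\bigl(g(R_i\cap S)+g(C_i\cap S)\bigr),\qquad g(S)=\begin{cases}\phi_t(|S|)&\text{if }(\ell,\ell)\in S\text{ for some }\ell\in[k],\\ \phi_n(|S|)&\text{otherwise,}\end{cases}$$ where $\phi_n(a)=\min\{a,\tfrac78k\}$ and $\phi_t(a)=\min\{\tfrac38ka,\ \tfrac38k+a-1,\ \tfrac78k\}$ are concave functions on $\mathbb{R}$; and for every $k\ge4$, $$\mathrm{OPT}\bigl(f^{(k)}\bigr)\le\frac{9k^2-4k}{4},\qquad \sum_{i=1}^k f^{(k)}(V_i)\ge\frac{10k^2-14k-1}{4}\ \text{ for every symmetric multiway partition } V_1,\dots,V_k .$$ -/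

import Mathlib

noncomputable section

namespace SymmetryGap

/-- The ground set `V = [k] × [k]`. -/
abbrev Grid (k : ℕ) : Type := Fin k × Fin k

/-- The row `R_i = {(i, j) : j ∈ [k]}`. -/
def row {k : ℕ} (i : Fin k) : Finset (Grid k) := Finset.univ.filter fun v => v.1 = i

/-- The column `C_i = {(j, i) : j ∈ [k]}`. -/
def col {k : ℕ} (i : Fin k) : Finset (Grid k) := Finset.univ.filter fun v => v.2 = i

/-- The diagonal `{(ℓ, ℓ) : ℓ ∈ [k]}`. -/
def diag (k : ℕ) : Finset (Grid k) := Finset.univ.filter fun v => v.1 = v.2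

/-- The transpose `Aᵀ = {(j, i) : (i, j) ∈ A}`. -/
def transpose {k : ℕ} (A : Finset (Grid k)) : Finset (Grid k) := A.image Prod.swap

/-- `f` is of row-column type: `f(A) = ∑_i (g(A ∩ R_i) + g(A ∩ C_i))` for some
non-negative set function `g`. -/
def IsRowColumnType {k : ℕ} (f : Finset (Grid k) → ℝ) : Prop :=
  ∃ g : Finset (Grid k) → ℝ, (∀ S, 0 ≤ g S) ∧
    ∀ A, f A = ∑ i : Fin k, (g (A ∩ row i) + g (A ∩ col i))

/-- Submodularity of a set function on a finite ground set. -/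
def IsSubmodular {α : Type*} [DecidableEq α] (f : Finset α → ℝ) : Prop :=
  ∀ A B : Finset α, f (A ∪ B) + f (A ∩ B) ≤ f A + f B

/-- `P_1, …, P_k` is a partition of `[k] × [k]` with `(i, i) ∈ P_i` for every `i`. -/
structure IsMultiwayPartition {k : ℕ} (P : Fin k → Finset (Grid k)) : Prop where
  disjoint : ∀ i j, i ≠ j → Disjoint (P i) (P j)
  cover : ∀ v, ∃ i, v ∈ P i
  terminal : ∀ i, (i, i) ∈ P i

/-- A multiway partition all of whose parts are invariant under transposition. -/
structure IsSymmetricMultiwayPartition {k : ℕ} (P : Fin k → Finset (Grid k)) : Prop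
    extends IsMultiwayPartition P where
  symm : ∀ i, P i = transpose (P i)

/-- The cost `∑_i f(P_i)`. -/
def cost {k : ℕ} (f : Finset (Grid k) → ℝ) (P : Fin k → Finset (Grid k)) : ℝ :=
  ∑ i, f (P i)

/-- `OPT(f)`, the least cost of a multiway partition (attained, see `isLeast_OPT`). -/
def OPT {k : ℕ} (f : Finset (Grid k) → ℝ) : ℝ :=
  sInf (cost f '' {P | IsMultiwayPartition P})

/-- `OPT_Sym(f)`, the least cost of a symmetric multiway partition
(attained, see `isLeast_OPTSym`). -/
def OPTSym {k : ℕ} (f : Finset (Grid k) → ℝ) : ℝ :=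
  sInf (cost f '' {P | IsSymmetricMultiwayPartition P})

/-- The symmetry gap `OPT_Sym(f) / OPT(f)`. -/
def symGap {k : ℕ} (f : Finset (Grid k) → ℝ) : ℝ := OPTSym f / OPT f

/-- `φ_n(a) = min {a, 7k/8}`. -/
def phiN (k : ℕ) (a : ℝ) : ℝ := min a (7 / 8 * k)

/-- `φ_t(a) = min {3ka/8, 3k/8 + a - 1, 7k/8}`. -/
def phiT (k : ℕ) (a : ℝ) : ℝ :=
  min (3 / 8 * k * a) (min (3 / 8 * k + a - 1) (7 / 8 * k))

/-- `g(S) = φ_t(|S|)` if `S` meets the diagonal, and `g(S) = φ_n(|S|)` otherwise. -/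
def gapG (k : ℕ) (S : Finset (Grid k)) : ℝ :=
  if (diag k ∩ S).Nonempty then phiT k S.card else phiN k S.card

/-- `f(S) = ∑_i (g(R_i ∩ S) + g(C_i ∩ S))`. -/
def gapF (k : ℕ) (S : Finset (Grid k)) : ℝ :=
  ∑ i : Fin k, (gapG k (row i ∩ S) + gapG k (col i ∩ S))

/-- A symmetric multiway partition exists: `(i, j) ∈ P_{min(i, j)}`. -/
theorem exists_isSymmetricMultiwayPartition (k : ℕ) :
    ∃ P : Fin k → Finset (Grid k), IsSymmetricMultiwayPartition P := by
  refine ⟨fun i => Finset.univ.filter fun v => min v.1 v.2 = i, ⟨⟨?_, ?_, ?_⟩, ?_⟩⟩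
  · intro i j hij
    rw [Finset.disjoint_left]
    intro v hi hj
    simp only [Finset.mem_filter, Finset.mem_univ, true_and] at hi hj
    exact hij (hi.symm.trans hj)
  · intro v
    exact ⟨min v.1 v.2, by simp⟩
  · intro i
    simp
  · intro i
    ext ⟨a, b⟩
    simp [transpose, min_comm]

/-- `OPT(f)` is a minimum. -/
theorem isLeast_OPT {k : ℕ} (f : Finset (Grid k) → ℝ) :
    IsLeast (cost f '' {P | IsMultiwayPartition P}) (OPT f) := by
  obtain ⟨P, hP⟩ := exists_isSymmetricMultiwayPartition k
  have hne : (cost f '' {P | IsMultiwayPartition P}).Nonempty :=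
    ⟨_, P, hP.toIsMultiwayPartition, rfl⟩
  have hfin : (cost f '' {P | IsMultiwayPartition P}).Finite := Set.toFinite _
  exact ⟨hne.csInf_mem hfin, fun _ hx => csInf_le hfin.bddBelow hx⟩

/-- `OPT_Sym(f)` is a minimum. -/
theorem isLeast_OPTSym {k : ℕ} (f : Finset (Grid k) → ℝ) :
    IsLeast (cost f '' {P | IsSymmetricMultiwayPartition P}) (OPTSym f) := by
  obtain ⟨P, hP⟩ := exists_isSymmetricMultiwayPartition k
  have hne : (cost f '' {P | IsSymmetricMultiwayPartition P}).Nonempty := ⟨_, P, hP, rfl⟩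
  have hfin : (cost f '' {P | IsSymmetricMultiwayPartition P}).Finite := Set.toFinite _
  exact ⟨hne.csInf_mem hfin, fun _ hx => csInf_le hfin.bddBelow hx⟩

end SymmetryGap

end

/-! A row or column contains exactly one diagonal cell, so on subsets of a line `gapG` is a weight
truncated at 7k/8, where diagonal cells weigh 3k/8 and all others 1. A line weighs 11k/8 - 1 <
2·7k/8, so at most one part per line is truncated, and the cost of a partition is 2k(11k/8 - 1)
minus the total truncated excess (the savings).

Call the part chosen for saving on a line own if it carries the index of the line, foreign
otherwise. A row and a column compete for their common cell unless they choose the same part.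
Counting cells (`cell_conflict`, `sum_savings_le`) bounds the savings by a quadratic in the numbers
s, t of own rows and columns and b, c of foreign ones. Its maximum is k²/2 in general (all rows
own), but only k²/4 when symmetry forces s = t and b = c. This gives costs of at least 9k²/4 and
10k²/4 up to O(k), and explicit partitions match both. -/

namespace SymmetryGap

/-! ### Truncated weights, monotonicity and submodularity -/

/-- The weight of a cell: `3k/8` on the diagonal, `1` elsewhere. -/
noncomputable def cellWeight (k : ℕ) (v : Grid k) : ℝ := if v.1 = v.2 then 3 / 8 * k else 1

/-- The total weight of a set of cells. -/
noncomputable def weight {k : ℕ} (S : Finset (Grid k)) : ℝ := ∑ v ∈ S, cellWeight k v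

theorem cellWeight_nonneg {k : ℕ} (v : Grid k) : 0 ≤ cellWeight k v := by
  unfold cellWeight
  split_ifs <;> positivity

theorem weight_nonneg {k : ℕ} (S : Finset (Grid k)) : 0 ≤ weight S :=
  Finset.sum_nonneg fun v _ => cellWeight_nonneg v

theorem weight_mono {k : ℕ} {S T : Finset (Grid k)} (h : S ⊆ T) : weight S ≤ weight T :=
  Finset.sum_le_sum_of_subset_of_nonneg h fun v _ _ => cellWeight_nonneg v

theorem weight_union_add_inter {k : ℕ} (S T : Finset (Grid k)) :
    weight (S ∪ T) + weight (S ∩ T) = weight S + weight T :=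
  Finset.sum_union_inter

theorem weight_eq {k : ℕ} (S : Finset (Grid k)) :
    weight S = S.card + (3 / 8 * k - 1) * (diag k ∩ S).card := by
  have h : (diag k ∩ S) = S.filter fun v => v.1 = v.2 := by
    ext v
    simp [diag, and_comm]
  rw [h, Finset.card_filter, Finset.card_eq_sum_ones]
  push_cast
  rw [Finset.mul_sum, ← Finset.sum_add_distrib]
  refine Finset.sum_congr rfl fun v _ => ?_
  unfold cellWeight
  split_ifs <;> ring

/-- For k ≥ 4 the diagonal weight 3k/8 exceeds 1, so at integers a ≥ 1 the branch 3ka/8 of `phiT` is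
never below 3k/8 + a - 1 and drops out. -/
theorem gapG_eq_min_weight {k : ℕ} (hk : 4 ≤ k) (S : Finset (Grid k))
    (hS : (diag k ∩ S).card ≤ 1) : gapG k S = min (weight S) (7 / 8 * k) := by
  have hk' : (4 : ℝ) ≤ k := by exact_mod_cast hk
  rw [weight_eq, gapG]
  split_ifs with h
  · have h1 : (diag k ∩ S).card = 1 := le_antisymm hS h.card_pos
    have h2 : (1 : ℝ) ≤ S.card := by
      exact_mod_cast h1 ▸ Finset.card_le_card Finset.inter_subset_right
    rw [h1, phiT, min_eq_right]
    · congr 1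
      push_cast
      ring
    · refine (min_le_left _ _).trans ?_
      nlinarith [mul_nonneg (sub_nonneg.2 h2) (by linarith : (0 : ℝ) ≤ 3 / 8 * k - 1)]
  · rw [Finset.not_nonempty_iff_eq_empty.1 h, phiN]
    simp

theorem card_diag_inter_row_inter_le_one {k : ℕ} (i : Fin k) (S : Finset (Grid k)) :
    (diag k ∩ (row i ∩ S)).card ≤ 1 := by
  refine Finset.card_le_one.2 ?_
  rintro ⟨a, b⟩ h ⟨c, d⟩ h'
  simp only [diag, row, Finset.mem_inter, Finset.mem_filter, Finset.mem_univ, true_and] at h h'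
  ext <;> simp <;> omega

theorem card_diag_inter_col_inter_le_one {k : ℕ} (i : Fin k) (S : Finset (Grid k)) :
    (diag k ∩ (col i ∩ S)).card ≤ 1 := by
  refine Finset.card_le_one.2 ?_
  rintro ⟨a, b⟩ h ⟨c, d⟩ h'
  simp only [diag, col, Finset.mem_inter, Finset.mem_filter, Finset.mem_univ, true_and] at h h'
  ext <;> simp <;> omega

theorem gapF_eq {k : ℕ} (hk : 4 ≤ k) (S : Finset (Grid k)) :
    gapF k S = ∑ i : Fin k, (min (weight (row i ∩ S)) (7 / 8 * k) +
      min (weight (col i ∩ S)) (7 / 8 * k)) := by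
  refine Finset.sum_congr rfl fun i _ => ?_
  rw [gapG_eq_min_weight hk _ (card_diag_inter_row_inter_le_one i S),
    gapG_eq_min_weight hk _ (card_diag_inter_col_inter_le_one i S)]

theorem gapF_mono {k : ℕ} (hk : 4 ≤ k) : Monotone (gapF k) := by
  intro S T h
  rw [gapF_eq hk, gapF_eq hk]
  exact Finset.sum_le_sum fun i _ => add_le_add
    (min_le_min_right _ (weight_mono (Finset.inter_subset_inter_left h)))
    (min_le_min_right _ (weight_mono (Finset.inter_subset_inter_left h)))

theorem gapF_nonneg {k : ℕ} (hk : 4 ≤ k) (S : Finset (Grid k)) : 0 ≤ gapF k S := by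
  rw [gapF_eq hk]
  exact Finset.sum_nonneg fun i _ => add_nonneg
    (le_min (weight_nonneg _) (by positivity)) (le_min (weight_nonneg _) (by positivity))

theorem min_weight_submodular {k : ℕ} (L A B : Finset (Grid k)) (c : ℝ) :
    min (weight (L ∩ (A ∪ B))) c + min (weight (L ∩ (A ∩ B))) c ≤
      min (weight (L ∩ A)) c + min (weight (L ∩ B)) c := by
  have h := weight_union_add_inter (L ∩ A) (L ∩ B)
  rw [← Finset.inter_union_distrib_left, ← Finset.inter_inter_distrib_left] at h
  have h1 : weight (L ∩ (A ∩ B)) ≤ weight (L ∩ A) :=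
    weight_mono (Finset.inter_subset_inter_left Finset.inter_subset_left)
  have h2 : weight (L ∩ (A ∩ B)) ≤ weight (L ∩ B) :=
    weight_mono (Finset.inter_subset_inter_left Finset.inter_subset_right)
  rcases min_cases (weight (L ∩ (A ∪ B))) c with h3 | h3 <;>
  rcases min_cases (weight (L ∩ (A ∩ B))) c with h4 | h4 <;>
  rcases min_cases (weight (L ∩ A)) c with h5 | h5 <;>
  rcases min_cases (weight (L ∩ B)) c with h6 | h6 <;>
  linarith

theorem gapF_submodular {k : ℕ} (hk : 4 ≤ k) : IsSubmodular (gapF k) := by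
  intro A B
  simp only [gapF_eq hk]
  rw [← Finset.sum_add_distrib, ← Finset.sum_add_distrib]
  refine Finset.sum_le_sum fun i _ => ?_
  linarith [min_weight_submodular (row i) A B (7 / 8 * k),
    min_weight_submodular (col i) A B (7 / 8 * k)]

theorem gapG_nonneg {k : ℕ} (hk : 4 ≤ k) (S : Finset (Grid k)) : 0 ≤ gapG k S := by
  have hk' : (4 : ℝ) ≤ k := by exact_mod_cast hk
  unfold gapG
  split_ifs with h
  · have h2 : (1 : ℝ) ≤ S.card := by
      exact_mod_cast (h.mono Finset.inter_subset_right).card_pos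
    refine le_min (by positivity) (le_min ?_ (by positivity))
    linarith
  · exact le_min (by positivity) (by positivity)

theorem gapF_isRowColumnType {k : ℕ} (hk : 4 ≤ k) : IsRowColumnType (gapF k) :=
  ⟨gapG k, gapG_nonneg hk, fun A => by simp only [gapF, Finset.inter_comm A]⟩

/-! ### Concavity of the two profiles -/

theorem concaveOn_phiN (k : ℕ) : ConcaveOn ℝ Set.univ (phiN k) :=
  (concaveOn_id convex_univ).inf (concaveOn_const _ convex_univ)

theorem concaveOn_phiT (k : ℕ) : ConcaveOn ℝ Set.univ (phiT k) := by
  have h1 : ConcaveOn ℝ Set.univ fun a : ℝ => 3 / 8 * (k : ℝ) * a :=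
    (concaveOn_id convex_univ).smul (c := 3 / 8 * (k : ℝ)) (by positivity)
  have h2 : ConcaveOn ℝ Set.univ fun a : ℝ => 3 / 8 * (k : ℝ) + a - 1 := by
    refine (((concaveOn_id convex_univ).add_const (3 / 8 * (k : ℝ) - 1))).congr fun a _ => ?_
    simp
    ring
  exact h1.inf (h2.inf (concaveOn_const _ convex_univ))

/-! ### Line weights and truncation -/

/-- The weight of the cells of row `l` that `o` assigns to part `i`. -/
noncomputable def rowWeight {k : ℕ} (o : Grid k → Fin k) (l i : Fin k) : ℝ :=
  ∑ m, if o (l, m) = i then cellWeight k (l, m) else 0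

/-- The weight of the cells of column `l` that `o` assigns to part `i`. -/
noncomputable def colWeight {k : ℕ} (o : Grid k → Fin k) (l i : Fin k) : ℝ :=
  rowWeight (o ∘ Prod.swap) l i

theorem cellWeight_swap {k : ℕ} (v : Grid k) : cellWeight k v.swap = cellWeight k v := by
  simp [cellWeight, eq_comm]

theorem weight_row_inter {k : ℕ} {o : Grid k → Fin k} {P : Fin k → Finset (Grid k)}
    (h : ∀ v i, v ∈ P i ↔ o v = i) (l i : Fin k) : weight (row l ∩ P i) = rowWeight o l i := by
  have : row l ∩ P i = Finset.univ.filter fun v : Grid k => v.1 = l ∧ o v = i := by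
    ext v
    simp [row, h]
  rw [weight, this, Finset.sum_filter, Fintype.sum_prod_type, Finset.sum_eq_single l]
  · simp [rowWeight]
  · intro b _ hb
    simp [hb]
  · simp

theorem weight_col_inter {k : ℕ} {o : Grid k → Fin k} {P : Fin k → Finset (Grid k)}
    (h : ∀ v i, v ∈ P i ↔ o v = i) (l i : Fin k) : weight (col l ∩ P i) = colWeight o l i := by
  have : col l ∩ P i = Finset.univ.filter fun v : Grid k => v.2 = l ∧ o v = i := by
    ext v
    simp [col, h]
  rw [weight, this, Finset.sum_filter, Fintype.sum_prod_type_right, Finset.sum_eq_single l]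
  · simp only [true_and, colWeight, rowWeight, Function.comp, Prod.swap_prod_mk]
    refine Finset.sum_congr rfl fun m _ => ?_
    rw [← cellWeight_swap (l, m), Prod.swap_prod_mk]
  · intro b _ hb
    simp [hb]
  · simp

theorem cost_gapF_eq {k : ℕ} (hk : 4 ≤ k) {o : Grid k → Fin k} {P : Fin k → Finset (Grid k)}
    (h : ∀ v i, v ∈ P i ↔ o v = i) :
    cost (gapF k) P = ∑ l, ∑ i, min (rowWeight o l i) (7 / 8 * k) +
      ∑ l, ∑ i, min (colWeight o l i) (7 / 8 * k) := by
  simp only [cost, gapF_eq hk, weight_row_inter h, weight_col_inter h]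
  rw [Finset.sum_comm]
  simp only [Finset.sum_add_distrib]

theorem rowWeight_nonneg {k : ℕ} (o : Grid k → Fin k) (l i : Fin k) : 0 ≤ rowWeight o l i :=
  Finset.sum_nonneg fun m _ => by
    split_ifs
    exacts [cellWeight_nonneg _, le_rfl]

theorem sum_rowWeight {k : ℕ} (o : Grid k → Fin k) (l : Fin k) :
    ∑ i, rowWeight o l i = 11 / 8 * k - 1 := by
  unfold rowWeight
  rw [Finset.sum_comm]
  have : ∀ m : Fin k, (if l = m then 3 / 8 * (k : ℝ) else 1) =
      1 + if l = m then 3 / 8 * (k : ℝ) - 1 else 0 := by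
    intro m
    split_ifs <;> ring
  simp only [Finset.sum_ite_eq, Finset.mem_univ, if_true, cellWeight, this,
    Finset.sum_add_distrib]
  simp
  ring

/-- If the total of `W` is below `2c`, then at most one entry is truncated at `c`. -/
theorem exists_sum_sub_le_sum_min {k : ℕ} (hk : 0 < k) (W : Fin k → ℝ) (hW : ∀ i, 0 ≤ W i) {c : ℝ}
    (hc : ∑ i, W i ≤ 2 * c) :
    ∃ j, ∃ z : ℝ, (z = 0 ∨ z = 1) ∧ ∑ i, W i - z * (W j - c) ≤ ∑ i, min (W i) c := by
  by_cases h : ∃ j, c < W j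
  · obtain ⟨j, hj⟩ := h
    refine ⟨j, 1, Or.inr rfl, ?_⟩
    rw [← Finset.add_sum_erase _ W (Finset.mem_univ j),
      ← Finset.add_sum_erase _ (fun i => min (W i) c) (Finset.mem_univ j)]
    -- As `W j` exceeds c and the total is at most 2c, the other entries sum to less than c.
    have : ∑ i ∈ Finset.univ.erase j, min (W i) c = ∑ i ∈ Finset.univ.erase j, W i := by
      refine Finset.sum_congr rfl fun i hi => min_eq_left ?_
      have h1 : W i ≤ ∑ i ∈ Finset.univ.erase j, W i :=
        Finset.single_le_sum (fun i _ => hW i) hi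
      rw [← Finset.add_sum_erase _ W (Finset.mem_univ j)] at hc
      linarith
    rw [this, min_eq_right hj.le]
    linarith
  · push Not at h
    -- The index is arbitrary, since z = 0 discards it.
    refine ⟨⟨0, hk⟩, 0, Or.inl rfl, ?_⟩
    simp [min_eq_left (h _)]

/-! ### Bounding the savings -/

/-- A cell cannot be in two different parts. -/
theorem cell_conflict {z z' : ℝ} (hz : z = 0 ∨ z = 1) (hz' : z' = 0 ∨ z' = 1) {k : ℕ}
    (o : Grid k → Fin k) (ho : ∀ i, o (i, i) = i) (a b p q : Fin k) {x y x' y' : ℝ}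
    (hx : x = if p = a then z else 0) (hy : y = z - x)
    (hx' : x' = if q = b then z' else 0) (hy' : y' = z' - x') :
    z * (if o (a, b) = p then cellWeight k (a, b) else 0) +
      z' * (if o (a, b) = q then cellWeight k (a, b) else 0) ≤
    z + z' - x * x' - y * x' - x * y' + (if b = p then y else 0) + (if a = q then y' else 0) +
      (if a = b then 3 / 8 * k * x + 3 / 8 * k * x' - y - y' else 0) := by
  subst hy hy' hx hx'
  -- On the diagonal the owner is a, so only own lines gain. Off it, the products charge a pair of
  -- chosen lines unless both are foreign; the `y` and `y'` terms refund a foreign line that wants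
  -- the crossing line's own part.
  by_cases hab : a = b
  · subst hab
    rw [ho]
    simp only [cellWeight, if_true, @eq_comm _ a p, @eq_comm _ a q]
    rcases hz with rfl | rfl <;> rcases hz' with rfl | rfl <;> split_ifs <;> norm_num
  · simp only [cellWeight, if_neg hab]
    rcases hz with rfl | rfl <;> rcases hz' with rfl | rfl <;> split_ifs <;>
      first | (exfalso; grind) | norm_num

/-- Summed over all cells, each foreign line gets one refund, which cancels the diagonal cell it
cannot have. Before the conflict products, an own line thus gains k + 3k/8 - 7k/8 = k/2 and a
foreign one k - 7k/8 = k/8. -/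
theorem sum_savings_le {k : ℕ} (o : Grid k → Fin k) (ho : ∀ i, o (i, i) = i)
    (j j' : Fin k → Fin k) (z z' : Fin k → ℝ) (hz : ∀ i, z i = 0 ∨ z i = 1)
    (hz' : ∀ i, z' i = 0 ∨ z' i = 1) {x y x' y' : Fin k → ℝ}
    (hx : ∀ i, x i = if j i = i then z i else 0) (hy : ∀ i, y i = z i - x i)
    (hx' : ∀ i, x' i = if j' i = i then z' i else 0) (hy' : ∀ i, y' i = z' i - x' i) :
    ∑ i, z i * (rowWeight o i (j i) - 7 / 8 * k) + ∑ i, z' i * (colWeight o i (j' i) - 7 / 8 * k) ≤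
      (∑ i, x i + ∑ i, x' i) * k / 2 + (∑ i, y i + ∑ i, y' i) * k / 8
        - (∑ i, x i) * (∑ i, x' i) - (∑ i, y i) * (∑ i, x' i) - (∑ i, x i) * (∑ i, y' i) := by
  have key := Finset.sum_le_sum fun a (_ : a ∈ Finset.univ) =>
    Finset.sum_le_sum fun b (_ : b ∈ Finset.univ) =>
    cell_conflict (hz a) (hz' b) o ho a b (j a) (j' b) (hx a) (hy a) (hx' b) (hy' b)
  have hr : ∑ a, ∑ b, z a * (if o (a, b) = j a then cellWeight k (a, b) else 0) =
      ∑ i, z i * rowWeight o i (j i) := by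
    simp only [rowWeight, Finset.mul_sum]
  have hc : ∑ a, ∑ b, z' b * (if o (a, b) = j' b then cellWeight k (a, b) else 0) =
      ∑ i, z' i * colWeight o i (j' i) := by
    rw [Finset.sum_comm]
    simp only [colWeight, rowWeight, Finset.mul_sum, Function.comp, Prod.swap_prod_mk]
    refine Finset.sum_congr rfl fun b _ => Finset.sum_congr rfl fun a _ => ?_
    rw [← cellWeight_swap (a, b), Prod.swap_prod_mk]
  have hzs : ∑ i, z i = ∑ i, x i + ∑ i, y i := by
    rw [← Finset.sum_add_distrib]
    exact Finset.sum_congr rfl fun i _ => by rw [hy]; ring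
  have hzs' : ∑ i, z' i = ∑ i, x' i + ∑ i, y' i := by
    rw [← Finset.sum_add_distrib]
    exact Finset.sum_congr rfl fun i _ => by rw [hy']; ring
  have hd : ∑ a, ∑ b, (if a = j' b then y' b else 0) = ∑ i, y' i := by
    rw [Finset.sum_comm]
    simp
  simp only [Finset.sum_add_distrib, Finset.sum_sub_distrib, hr, hc, hd] at key
  simp only [Finset.sum_ite_eq, Finset.sum_ite_eq', Finset.mem_univ, if_true,
    Finset.sum_add_distrib, Finset.sum_sub_distrib, ← Finset.mul_sum, ← Finset.sum_mul,
    Finset.sum_const, Finset.card_univ, Fintype.card_fin, nsmul_eq_mul, hzs, hzs'] at key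
  simp only [mul_sub, Finset.sum_sub_distrib, ← Finset.sum_mul, hzs, hzs']
  linarith

theorem exists_owner {k : ℕ} {P : Fin k → Finset (Grid k)} (hP : IsMultiwayPartition P) :
    ∃ o : Grid k → Fin k, (∀ v i, v ∈ P i ↔ o v = i) ∧ ∀ i, o (i, i) = i := by
  choose o ho using hP.cover
  have h : ∀ v i, v ∈ P i ↔ o v = i := by
    refine fun v i => ⟨fun hv => ?_, fun hv => hv ▸ ho v⟩
    by_contra hne
    exact Finset.disjoint_left.1 (hP.disjoint _ _ hne) (ho v) hv
  exact ⟨o, h, fun i => (h _ _).1 (hP.terminal i)⟩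

theorem exists_row_savings {k : ℕ} (hk : 4 ≤ k) (o : Grid k → Fin k) :
    ∃ (j : Fin k → Fin k) (z : Fin k → ℝ), (∀ l, z l = 0 ∨ z l = 1) ∧
      k * (11 / 8 * k - 1) - ∑ l, z l * (rowWeight o l (j l) - 7 / 8 * k) ≤
        ∑ l, ∑ i, min (rowWeight o l i) (7 / 8 * k) := by
  have h := fun l => exists_sum_sub_le_sum_min (by omega) (rowWeight o l) (rowWeight_nonneg o l)
    (c := 7 / 8 * k) (by
      rw [sum_rowWeight]
      have : (0 : ℝ) ≤ k := by positivity
      linarith)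
  choose j z hz hs using h
  refine ⟨j, z, hz, le_trans (le_of_eq ?_) (Finset.sum_le_sum fun l _ => hs l)⟩
  simp only [sum_rowWeight, Finset.sum_sub_distrib, Finset.sum_const, Finset.card_univ,
    Fintype.card_fin, nsmul_eq_mul]
  ring

theorem sum_own_foreign {k : ℕ} {j : Fin k → Fin k} {z x y : Fin k → ℝ}
    (hz : ∀ i, z i = 0 ∨ z i = 1)
    (hx : ∀ i, x i = if j i = i then z i else 0) (hy : ∀ i, y i = z i - x i) :
    0 ≤ ∑ i, x i ∧ 0 ≤ ∑ i, y i ∧ ∑ i, x i + ∑ i, y i ≤ k := by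
  have hz0 : ∀ i, 0 ≤ z i ∧ z i ≤ 1 := fun i => by
    rcases hz i with h | h <;> rw [h] <;> norm_num
  refine ⟨Finset.sum_nonneg fun i _ => ?_, Finset.sum_nonneg fun i _ => ?_, ?_⟩
  · rw [hx]
    split_ifs
    exacts [(hz0 i).1, le_rfl]
  · rw [hy, hx]
    split_ifs <;> simp [(hz0 i).1]
  · rw [← Finset.sum_add_distrib]
    refine (Finset.sum_le_sum fun i _ => (?_ : x i + y i ≤ 1)).trans (by simp)
    rw [hy]
    linarith [(hz0 i).2]

/-- The left side is affine in (s, b) and in (t, c) separately, so it is extremal at vertices of the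
two triangles; the value k²/2 occurs at s = k, t = b = c = 0. -/
theorem savings_general_le {s t b c k : ℝ} (hs : 0 ≤ s) (ht : 0 ≤ t) (hb : 0 ≤ b) (hc : 0 ≤ c)
    (hsb : s + b ≤ k) (htc : t + c ≤ k) :
    (s + t) * k / 2 + (b + c) * k / 8 - s * t - b * t - s * c ≤ k ^ 2 / 2 := by
  nlinarith [mul_nonneg hs ht, mul_nonneg hb ht, mul_nonneg hs hc, mul_nonneg hb hc,
    mul_nonneg (sub_nonneg.2 hsb) (sub_nonneg.2 htc), mul_nonneg (sub_nonneg.2 hsb) ht,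
    mul_nonneg (sub_nonneg.2 hsb) hc, mul_nonneg hs (sub_nonneg.2 htc),
    mul_nonneg hb (sub_nonneg.2 htc), sq_nonneg (s - t)]

/-- The left side is s(k - s) - 2b(s - k/8). For s ≥ k/8 the best choice is b = 0, for s ≤ k/8 it is
b = k - s. -/
theorem savings_symmetric_le {s b k : ℝ} (hs : 0 ≤ s) (hb : 0 ≤ b) (hsb : s + b ≤ k) :
    (s + s) * k / 2 + (b + b) * k / 8 - s * s - b * s - s * b ≤ k ^ 2 / 4 := by
  rcases le_total (k / 8) s with h | h
  · nlinarith [sq_nonneg (s - k / 2), mul_nonneg hb (sub_nonneg.2 h)]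
  · nlinarith [mul_nonneg (sub_nonneg.2 hsb) (sub_nonneg.2 h), mul_nonneg hs (sub_nonneg.2 h),
      mul_nonneg hs (sub_nonneg.2 hsb), mul_nonneg hs hs, mul_nonneg hs hb]

theorem le_cost_gapF {k : ℕ} (hk : 4 ≤ k) {P : Fin k → Finset (Grid k)}
    (hP : IsMultiwayPartition P) : (9 * (k : ℝ) ^ 2 - 8 * k) / 4 ≤ cost (gapF k) P := by
  obtain ⟨o, h, ho⟩ := exists_owner hP
  obtain ⟨j, z, hz, hr⟩ := exists_row_savings hk o
  obtain ⟨j', z', hz', hc⟩ := exists_row_savings hk (o ∘ Prod.swap)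
  have hsum := sum_savings_le o ho j j' z z' hz hz' (fun _ => rfl) (fun _ => rfl)
    (fun _ => rfl) (fun _ => rfl)
  obtain ⟨h1, h2, h3⟩ := sum_own_foreign (j := j) hz (fun _ => rfl) (fun _ => rfl)
  obtain ⟨h4, h5, h6⟩ := sum_own_foreign (j := j') hz' (fun _ => rfl) (fun _ => rfl)
  have hle := savings_general_le h1 h4 h2 h5 h3 h6
  rw [cost_gapF_eq hk h]
  simp only [colWeight] at hsum ⊢
  linarith

theorem le_cost_gapF_of_symmetric {k : ℕ} (hk : 4 ≤ k) {P : Fin k → Finset (Grid k)}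
    (hP : IsSymmetricMultiwayPartition P) :
    (10 * (k : ℝ) ^ 2 - 8 * k) / 4 ≤ cost (gapF k) P := by
  obtain ⟨o, h, ho⟩ := exists_owner hP.toIsMultiwayPartition
  -- Row and column weights coincide, so the same choices `j`, `z` serve both.
  have hswap : o ∘ Prod.swap = o := by
    funext v
    have hv : v.swap ∈ P (o v) := by
      rw [hP.symm]
      exact Finset.mem_image_of_mem _ ((h _ _).2 rfl)
    exact (h _ _).1 hv
  obtain ⟨j, z, hz, hr⟩ := exists_row_savings hk o
  have hsum := sum_savings_le o ho j j z z hz hz (fun _ => rfl) (fun _ => rfl)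
    (fun _ => rfl) (fun _ => rfl)
  obtain ⟨h1, h2, h3⟩ := sum_own_foreign (j := j) hz (fun _ => rfl) (fun _ => rfl)
  have hle := savings_symmetric_le h1 h2 h3
  rw [cost_gapF_eq hk h]
  simp only [colWeight, hswap] at hsum ⊢
  linarith

/-! ### Explicit near-optimal partitions -/

/-- The parts of an assignment of cells to terminals. -/
def fibers {k : ℕ} (o : Grid k → Fin k) (i : Fin k) : Finset (Grid k) :=
  Finset.univ.filter fun v => o v = i

theorem mem_fibers {k : ℕ} (o : Grid k → Fin k) (v : Grid k) (i : Fin k) :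
    v ∈ fibers o i ↔ o v = i := by
  simp [fibers]

theorem isMultiwayPartition_fibers {k : ℕ} {o : Grid k → Fin k} (ho : ∀ i, o (i, i) = i) :
    IsMultiwayPartition (fibers o) where
  disjoint i j hij := Finset.disjoint_left.2 fun v hi hj =>
    hij (((mem_fibers o v i).1 hi).symm.trans ((mem_fibers o v j).1 hj))
  cover v := ⟨o v, (mem_fibers o v _).2 rfl⟩
  terminal i := (mem_fibers o _ i).2 (ho i)

theorem isSymmetricMultiwayPartition_fibers {k : ℕ} {o : Grid k → Fin k} (ho : ∀ i, o (i, i) = i)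
    (hs : ∀ v, o v.swap = o v) : IsSymmetricMultiwayPartition (fibers o) where
  toIsMultiwayPartition := isMultiwayPartition_fibers ho
  symm i := by
    ext v
    rw [transpose, Finset.mem_image, mem_fibers]
    constructor
    · intro hv
      exact ⟨v.swap, (mem_fibers _ _ _).2 ((hs v).trans hv), Prod.swap_swap v⟩
    · rintro ⟨u, hu, rfl⟩
      exact (hs u).trans ((mem_fibers _ _ _).1 hu)

/-- Part l is the whole row l: every row is truncated to 7k/8 and every column costs at most its
full weight. -/
theorem OPT_gapF_le {k : ℕ} (hk : 4 ≤ k) : OPT (gapF k) ≤ (9 * (k : ℝ) ^ 2 - 4 * k) / 4 := by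
  have ho : ∀ i : Fin k, Prod.fst (i, i) = i := fun _ => rfl
  refine ((isLeast_OPT (gapF k)).2 ⟨_, isMultiwayPartition_fibers ho, rfl⟩).trans ?_
  rw [cost_gapF_eq hk (mem_fibers _)]
  have hrow : ∀ l : Fin k, ∑ i, min (rowWeight Prod.fst l i) (7 / 8 * (k : ℝ)) ≤ 7 / 8 * k := by
    intro l
    rw [Finset.sum_eq_single l]
    · exact min_le_right _ _
    · intro i _ hi
      simp only [rowWeight, if_neg (Ne.symm hi), Finset.sum_const_zero]
      exact min_eq_left (by positivity)
    · simp
  have hcol : ∀ l : Fin k, ∑ i, min (colWeight Prod.fst l i) (7 / 8 * (k : ℝ)) ≤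
      11 / 8 * k - 1 := fun l =>
    (Finset.sum_le_sum fun i _ => min_le_left _ _).trans_eq (sum_rowWeight _ l)
  refine (add_le_add (Finset.sum_le_sum fun l _ => hrow l)
    (Finset.sum_le_sum fun l _ => hcol l)).trans_eq ?_
  simp
  ring

/-- One part takes all off-diagonal cells, so a line costs at most 7k/8 for that part plus 3k/8 for
its diagonal cell. -/
theorem OPTSym_gapF_le {k : ℕ} (hk : 4 ≤ k) : OPTSym (gapF k) ≤ 10 * (k : ℝ) ^ 2 / 4 := by
  let e : Fin k := ⟨0, by omega⟩
  let o : Grid k → Fin k := fun v => if v.1 = v.2 then v.1 else e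
  have ho : ∀ i : Fin k, o (i, i) = i := fun i => by simp [o]
  have hs : ∀ v : Grid k, o v.swap = o v := fun v => by
    by_cases h : v.1 = v.2
    · simp [o, h]
    · simp [o, h, Ne.symm h]
  have hswap : o ∘ Prod.swap = o := funext hs
  refine ((isLeast_OPTSym (gapF k)).2
    ⟨_, isSymmetricMultiwayPartition_fibers ho hs, rfl⟩).trans ?_
  rw [cost_gapF_eq hk (mem_fibers _)]
  have hrow : ∀ l : Fin k, ∑ i, min (rowWeight o l i) (7 / 8 * (k : ℝ)) ≤ 10 / 8 * k := by
    intro l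
    rw [← Finset.add_sum_erase _ _ (Finset.mem_univ e)]
    have h1 : ∑ i ∈ Finset.univ.erase e, min (rowWeight o l i) (7 / 8 * (k : ℝ)) ≤
        ∑ i, if i = l then 3 / 8 * (k : ℝ) else 0 := by
      refine (Finset.sum_le_sum fun i hi => ?_).trans
        (Finset.sum_le_sum_of_subset_of_nonneg (Finset.subset_univ _) fun i _ _ => by
          split_ifs <;> positivity)
      refine (min_le_left _ _).trans ?_
      have hi' : e ≠ i := (Finset.ne_of_mem_erase hi).symm
      rw [rowWeight, Finset.sum_eq_single l]
      · rw [ho]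
        simp only [cellWeight, if_true, eq_comm (a := l)]
        exact le_rfl
      · intro m _ hm
        simp [o, hm.symm, hi']
      · simp
    simp only [Finset.sum_ite_eq', Finset.mem_univ, if_true] at h1
    linarith [min_le_right (rowWeight o l e) (7 / 8 * (k : ℝ))]
  simp only [colWeight, hswap]
  refine (add_le_add (Finset.sum_le_sum fun l _ => hrow l)
    (Finset.sum_le_sum fun l _ => hrow l)).trans_eq ?_
  simp
  ring

/-! ### The limit of the gap -/

theorem le_OPT_gapF {k : ℕ} (hk : 4 ≤ k) : (9 * (k : ℝ) ^ 2 - 8 * k) / 4 ≤ OPT (gapF k) := by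
  obtain ⟨P, hP, h⟩ := (isLeast_OPT (gapF k)).1
  exact h ▸ le_cost_gapF hk hP

theorem le_OPTSym_gapF {k : ℕ} (hk : 4 ≤ k) :
    (10 * (k : ℝ) ^ 2 - 8 * k) / 4 ≤ OPTSym (gapF k) := by
  obtain ⟨P, hP, h⟩ := (isLeast_OPTSym (gapF k)).1
  exact h ▸ le_cost_gapF_of_symmetric hk hP

theorem symGap_gapF_le {k : ℕ} (hk : 4 ≤ k) : symGap (gapF k) ≤ 10 / (9 - 8 / (k : ℝ)) := by
  have hk' : (4 : ℝ) ≤ k := by exact_mod_cast hk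
  have h0 : (0 : ℝ) < 9 * k - 8 := by linarith
  have : 10 / (9 - 8 / (k : ℝ)) = (10 * (k : ℝ) ^ 2 / 4) / ((9 * (k : ℝ) ^ 2 - 8 * k) / 4) := by
    have h1 : 9 - 8 / (k : ℝ) = (9 * k - 8) / k := by field_simp
    have h2 : 9 * (k : ℝ) ^ 2 - 8 * k = k * (9 * k - 8) := by ring
    rw [h1, h2]
    field_simp
  rw [this, symGap]
  exact div_le_div₀ (by positivity) (OPTSym_gapF_le hk) (by nlinarith) (le_OPT_gapF hk)

theorem le_symGap_gapF {k : ℕ} (hk : 4 ≤ k) :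
    (10 - 8 / (k : ℝ)) / 9 ≤ symGap (gapF k) := by
  have hk' : (4 : ℝ) ≤ k := by exact_mod_cast hk
  have : (10 - 8 / (k : ℝ)) / 9 = ((10 * (k : ℝ) ^ 2 - 8 * k) / 4) / (9 * (k : ℝ) ^ 2 / 4) := by
    field_simp
  rw [this, symGap]
  have h1 := le_OPT_gapF hk
  have h2 := OPT_gapF_le hk
  have h3 := le_OPTSym_gapF hk
  exact div_le_div₀ (by nlinarith) h3 (by nlinarith) (by linarith)

theorem tendsto_symGap_gapF :
    Filter.Tendsto (fun k : ℕ => symGap (gapF k)) Filter.atTop (nhds (10 / 9)) := by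
  have h8 := tendsto_const_div_atTop_nhds_zero_nat (8 : ℝ)
  refine tendsto_of_tendsto_of_tendsto_of_le_of_le' (g := fun k : ℕ => (10 - 8 / (k : ℝ)) / 9)
    (h := fun k : ℕ => 10 / (9 - 8 / (k : ℝ))) ?_ ?_ ?_ ?_
  · simpa using (h8.const_sub 10).div_const 9
  · simpa [Pi.div_def] using
      (tendsto_const_nhds (x := (10 : ℝ))).div (h8.const_sub 9) (by norm_num)
  · filter_upwards [Filter.eventually_ge_atTop 4] with k hk using le_symGap_gapF hk
  · filter_upwards [Filter.eventually_ge_atTop 4] with k hk using symGap_gapF_le hk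

end SymmetryGap

theorem mainTheorem4 :
    ∃ f : (k : ℕ) → Finset (Fin k × Fin k) → ℝ,
      (∀ k : ℕ, SymmetryGap.IsRowColumnType (f k) ∧ (∀ S, 0 ≤ f k S) ∧ Monotone (f k) ∧
        SymmetryGap.IsSubmodular (f k)) ∧
      (∀ k : ℕ, 4 ≤ k →
        ConcaveOn ℝ Set.univ (SymmetryGap.phiN k) ∧ ConcaveOn ℝ Set.univ (SymmetryGap.phiT k) ∧
        f k = SymmetryGap.gapF k ∧
        SymmetryGap.OPT (f k) ≤ (9 * (k : ℝ) ^ 2 - 4 * k) / 4 ∧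
        ∀ P : Fin k → Finset (Fin k × Fin k), SymmetryGap.IsSymmetricMultiwayPartition P →
          (10 * (k : ℝ) ^ 2 - 14 * k - 1) / 4 ≤ ∑ i, f k (P i)) ∧
      Filter.Tendsto (fun k : ℕ => SymmetryGap.symGap (f k)) Filter.atTop (nhds (10 / 9)) := by
  -- The weight form is established for k ≥ 4; below that the zero function has the required
  -- properties and does not affect the limit.
  refine ⟨fun k => if 4 ≤ k then SymmetryGap.gapF k else fun _ => 0, fun k => ?_, fun k hk => ?_, ?_⟩
  · by_cases hk : 4 ≤ k
    · simp only [if_pos hk]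
      exact ⟨SymmetryGap.gapF_isRowColumnType hk, SymmetryGap.gapF_nonneg hk,
        SymmetryGap.gapF_mono hk, SymmetryGap.gapF_submodular hk⟩
    · simp only [if_neg hk]
      exact ⟨⟨fun _ => 0, fun _ => le_rfl, fun A => by simp⟩, fun _ => le_rfl,
        monotone_const, fun A B => le_rfl⟩
  · simp only [if_pos hk]
    refine ⟨SymmetryGap.concaveOn_phiN k, SymmetryGap.concaveOn_phiT k, trivial,
      SymmetryGap.OPT_gapF_le hk, fun P hP => ?_⟩
    have h := SymmetryGap.le_cost_gapF_of_symmetric hk hP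
    have hk' : (4 : ℝ) ≤ k := by exact_mod_cast hk
    -- The bound 10k² - 8k proved above is sharper than the required 10k² - 14k - 1.
    refine le_trans ?_ h
    linarith
  · refine SymmetryGap.tendsto_symGap_gapF.congr' ?_
    filter_upwards [Filter.eventually_ge_atTop 4] with k hk
    rw [if_pos hk]
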